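/- **Setting.** Featherweight Java (FJ) has class declarations $L=\mathtt{class}\ C\ \mathtt{extends}\ D\ \{\overline{C}\ \overline f;\ K\ \overline M\}$, methods $M = C_0\ m(\overline C\ \overline x)\{\mathtt{return}\ e;\}$ and expressions $e::=x\mid\mathtt{this}\mid e.f\mid e.m(\overline e)\mid \mathtt{new}\ C(\overline e)\mid (C)e$. A *class table* $CT$ is a finite set of clauses $C\ \mathtt{extends}\ D$, $C.\mathtt{init}(\overline C)$, $C.f:C'$, $C.m:\overline C\to C'$ with at most one clause for each $C.\mathtt{extends}$, $C.\mathtt{init}$, $C.f$, $C.m$; $\mathrm{ext}(CT)=\{(C,D)\mid (C\ \mathtt{extends}\ D)\in CT\}$, and $<:$ is the reflexive transitive closure of $\mathrm{ext}(CT)$. Field and method lookup $\mathrm{field}(f,C,CT)$, $\mathrm{mtype}(m,C,CT)$ return the first declaration in $C$ or its superclasses; $\mathrm{fields}(C,CT)=C.\mathtt{init}(\overline C)$ returns the constructor clause of $C$. The judgment $CT\vdash L\ \mathrm{OK}$ is the FJ typing of class declarations relative to $CT$: the constructor has the form $K=C(\overline{D}'\,\overline g,\overline{C}'\,\overline f)\{\mathtt{super}(\overline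 g);\mathtt{this}.\overline f=\overline f\}$, $\mathrm{fields}(D,CT)=D.\mathtt{init}(\overline{D}')$, and each method $C_0\ m(\overline C\ \overline x)\{\mathtt{return}\ e;\}$ is OK in $C$, i.e. under $\overline x:\overline C,\mathtt{this}:C$ its body has a type $E_0<:C_0$, and there is $D_1$ with $(C\ \mathtt{extends}\ D_1)\in CT$ such that $\mathrm{mtype}(m,D_1,CT)$, if defined, equals $\overline C\to C_0$. *Class types* $T$ are class names or class variables $U$. *Constraints* are $T=T'$, $T\ne T'$, $T<:T'$, $T\not<:T'$ and equalities of types or of sequences of types under a condition; a condition is a conjunction of atoms $T=T'$, $T\neq T'$. *Class table requirements* $CR$ are sets of pairs $(\mathit{CReq},\mathit{cond})$ with $\mathit{CReq}$ of the form $T.\mathtt{extends}:T'$, $T.\mathtt{init}(\overline T)$, $T.f:T'$, $T.m:\overline T\to T'$ or the optional $(T.m:\overline T\to T')_{opt}$. The co-contextual judgment $\vdash_c L\ \mathrm{OK}\mid S\mid CR$ types $L$ bottom-up without a class table: each use of a variable, field, method or constructor gets fresh class variables and yields a requirement, each method declaration of $L$ with signature $m:\overline C\to C_0$ yields $U_c.\mathtt{extends}:U_d$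 and $(U_d.m:\overline C\to C_0)_{opt}$ with $U_c,U_d$ fresh and the constraint $U_c=C$, and the constructor yields $D.\mathtt{init}(\overline{D}')$. Subtyping, equality and cast checks become constraints in $S$. Requirements of different subterms are merged by $\mathrm{merge}_{CR}$: non-overlapping requirements are kept; for two overlapping ones (both on $\mathtt{extends}$, both on $\mathtt{init}$, both on the same field name, or both on the same method name, optional or not) with receivers $T_1,T_2$ and conditions $c_1,c_2$, both are kept, with the added condition $T_1\neq T_2$, and a common requirement with condition $c_1\wedge c_2\wedge T_1=T_2$ is added (the first of the two, optional only if both are), while constraints equating their types if $T_1=T_2$ are added to $S$. For a binary relation $\Sigma$ on class names and a substitution $\sigma$ from class variables to class types, $\mathrm{solve}(\Sigma,S)=\sigma$ means that $\sigma$ satisfies every constraint of $S$, where $<:$ is read as the reflexive transitive closure of $\Sigma$ on class names; $\sigma$ is a *ground solution* if $\sigma(CR)$ (requirements and conditions) contains no class variable. A class table $CT$ *satisfies* $\sigma(CR)$ if for every $(\mathit{CReq},\mathit{cond})\in\sigma(CR)$ such that $\mathit{cond}$ holds: the clause $C\ \mathtt{extends}\ D$ is in $CT$ for $\mathit{CReq}=C.\mathtt{extends}:D$;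 $\mathrm{fields}(C,CT)=C.\mathtt{init}(\overline C)$ for $C.\mathtt{init}(\overline C)$; $\mathrm{field}(f,C,CT)=C'$ for $C.f:C'$; $\mathrm{mtype}(m,C,CT)=\overline C\to C'$ for $C.m:\overline C\to C'$; and for $(C.m:\overline C\to C')_{opt}$, $\mathrm{mtype}(m,C,CT)$, if defined, is $\overline C\to C'$. **Theorem (Equivalence of classes: $\Leftarrow$).** Let $L=\mathtt{class}\ C\ \mathtt{extends}\ D\ \{\overline C\ \overline f;\ K\ \overline M\}$ with $\vdash_c L\ \mathrm{OK}\mid S\mid CR$, let $\Sigma$ be the immediate subclass relation $\mathrm{ext}(CT_0)$ of some class table $CT_0$, and let $\mathrm{solve}(\Sigma,S)=\sigma$, where $\sigma$ is a ground solution. Assume that $\Sigma$ records the inheritance demanded by $CR$: $(C_1,C_2)\in\Sigma$ whenever $(C_1.\mathtt{extends}:C_2,\ \mathit{cond})\in\sigma(CR)$ and $\mathit{cond}$ holds. Then there exists a class table $CT$ such that $CT\vdash L\ \mathrm{OK}$, $CT$ satisfies $\sigma(CR)$, and $\mathrm{ext}(CT)=\Sigma$. -/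

import Mathlib

/-! Featherweight Java with explicit class tables, and its co-contextual formulation. -/

namespace FJ

/-! ### Names and syntax -/

abbrev CName := ℕ
abbrev FName := ℕ
abbrev MName := ℕ

/-- Term variables: ordinary (parameter) names and the self reference `this`. -/
inductive Var where
  | this : Var
  | param : ℕ → Var
  deriving DecidableEq

inductive Expr where
  | var : Var → Expr
  | field : Expr → FName → Expr
  | invk : Expr → MName → List Expr → Expr
  | new : CName → List Expr → Expr
  | cast : CName → Expr → Expr

/-- A method declaration `ret name(params) { return body; }`. -/
structure MethodDecl where
  ret : CName
  name : MName
  params : List (CName × ℕ)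
  body : Expr

/-- A constructor `name(params) { super(superArgs); this.f = g; ... }`, with one pair `(f, g)` in
`inits` for each assignment `this.f = g`. -/
structure CtorDecl where
  name : CName
  params : List (CName × FName)
  superArgs : List FName
  inits : List (FName × FName)

structure ClassDecl where
  name : CName
  super : CName
  fields : List (CName × FName)
  ctor : CtorDecl
  methods : List MethodDecl

/-- `K = C(D' g, C' f) { super(g); this.f = f }`, where `f` are the names of the declared fields
and `Dg`, `Cf` are the two groups of typed parameters. -/
def ClassDecl.CtorForm (L : ClassDecl) (Dg Cf : List (CName × FName)) : Prop :=
  Cf.map Prod.snd = L.fields.map Prod.snd ∧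
  L.ctor =
    { name := L.name
      params := Dg ++ Cf
      superArgs := Dg.map Prod.snd
      inits := (Cf.map Prod.snd).map fun f => (f, f) }

/-! ### Class tables -/

/-- What a clause or a requirement on a class is about. -/
inductive Slot where
  | ext : Slot
  | init : Slot
  | field : FName → Slot
  | method : MName → Slot
  deriving DecidableEq

/-- Class table clauses `C extends D`, `C.init(Cs)`, `C.f : C'` and `C.m : Cs → C'`. -/
inductive Clause where
  | ext (C D : CName) : Clause
  | init (C : CName) (Cs : List CName) : Clause
  | field (C : CName) (f : FName) (C' : CName) : Clause
  | method (C : CName) (m : MName) (Cs : List CName) (C' : CName) : Clause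

/-- The domain `C.extends`, `C.init`, `C.f` or `C.m` of a clause. -/
def Clause.dom : Clause → CName × Slot
  | .ext C _ => (C, .ext)
  | .init C _ => (C, .init)
  | .field C f _ => (C, .field f)
  | .method C m _ _ => (C, .method m)

/-- A class table: a finite set of clauses with at most one clause for each domain element. -/
structure ClassTable where
  clauses : Set Clause
  finite : clauses.Finite
  unique : ∀ c ∈ clauses, ∀ c' ∈ clauses, c.dom = c'.dom → c = c'

/-- The immediate subclass relation of a class table. -/
def ClassTable.ext (CT : ClassTable) : Set (CName × CName) :=
  {p | Clause.ext p.1 p.2 ∈ CT.clauses}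

/-- Subtyping relative to an immediate subclass relation: its reflexive transitive closure. -/
def SubRel (Sg : Set (CName × CName)) : CName → CName → Prop :=
  Relation.ReflTransGen fun C D => (C, D) ∈ Sg

def ClassTable.Sub (CT : ClassTable) : CName → CName → Prop :=
  SubRel CT.ext

/-- `extends(C, CT) = D`. -/
def ClassTable.Extends (CT : ClassTable) (C D : CName) : Prop :=
  Clause.ext C D ∈ CT.clauses

/-- `fields(C, CT) = C.init(Cs)`: the constructor signature of `C`. -/
def ClassTable.Fields (CT : ClassTable) (C : CName) (Cs : List CName) : Prop :=
  Clause.init C Cs ∈ CT.clauses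

/-- `field(f, C, CT) = C'`: the first declaration of `f` in `C` or its superclasses. -/
inductive ClassTable.Field (CT : ClassTable) (f : FName) : CName → CName → Prop
  | here {C C' : CName} : Clause.field C f C' ∈ CT.clauses → CT.Field f C C'
  | up {C D C' : CName} : (∀ A, Clause.field C f A ∉ CT.clauses) → CT.Extends C D →
      CT.Field f D C' → CT.Field f C C'

/-- `mtype(m, C, CT) = Cs → C'`: the first declaration of `m` in `C` or its superclasses. -/
inductive ClassTable.MType (CT : ClassTable) (m : MName) : CName → List CName → CName → Prop
  | here {C C' : CName} {Cs : List CName} :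
      Clause.method C m Cs C' ∈ CT.clauses → CT.MType m C Cs C'
  | up {C D C' : CName} {Cs : List CName} : (∀ As A, Clause.method C m As A ∉ CT.clauses) →
      CT.Extends C D → CT.MType m D Cs C' → CT.MType m C Cs C'

/-! ### Contextual typing -/

abbrev Ctx := Var → Option CName

/-- The context `x₁ : C₁, ..., xₙ : Cₙ, this : C` of a method body. -/
def methodCtx (params : List (CName × ℕ)) (C : CName) : Ctx
  | .this => some C
  | .param x => (params.find? fun p => p.2 = x).map Prod.fst

inductive HasType (CT : ClassTable) (Γ : Ctx) : Expr → CName → Prop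
  | var {x : Var} {C : CName} : Γ x = some C → HasType CT Γ (.var x) C
  | field {e : Expr} {f : FName} {Ce Ci : CName} :
      HasType CT Γ e Ce → CT.Field f Ce Ci → HasType CT Γ (.field e f) Ci
  | invk {e : Expr} {m : MName} {es : List Expr} {Ce C : CName}
      {Cs Ds : Fin es.length → CName} :
      HasType CT Γ e Ce → (∀ i, HasType CT Γ (es.get i) (Cs i)) →
      CT.MType m Ce (List.ofFn Ds) C → (∀ i, CT.Sub (Cs i) (Ds i)) →
      HasType CT Γ (.invk e m es) C
  | new {C : CName} {es : List Expr} {Cs Ds : Fin es.length → CName} :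
      (∀ i, HasType CT Γ (es.get i) (Cs i)) → CT.Fields C (List.ofFn Ds) →
      (∀ i, CT.Sub (Cs i) (Ds i)) → HasType CT Γ (.new C es) C
  | ucast {C D : CName} {e : Expr} :
      HasType CT Γ e D → CT.Sub D C → HasType CT Γ (.cast C e) C
  | dcast {C D : CName} {e : Expr} :
      HasType CT Γ e D → CT.Sub C D → C ≠ D → HasType CT Γ (.cast C e) C
  | scast {C D : CName} {e : Expr} :
      HasType CT Γ e D → ¬ CT.Sub C D → ¬ CT.Sub D C → HasType CT Γ (.cast C e) C

/-- The method `M`, declared in class `C`, is OK. -/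
def MethodOK (CT : ClassTable) (C : CName) (M : MethodDecl) : Prop :=
  (∃ E₀, HasType CT (methodCtx M.params C) M.body E₀ ∧ CT.Sub E₀ M.ret) ∧
  ∃ D, CT.Extends C D ∧
    ∀ Ds D₀, CT.MType M.name D Ds D₀ → M.params.map Prod.fst = Ds ∧ M.ret = D₀

def ClassOK (CT : ClassTable) (L : ClassDecl) : Prop :=
  ∃ Dg Cf, L.CtorForm Dg Cf ∧ CT.Fields L.super (Dg.map Prod.fst) ∧
    ∀ M ∈ L.methods, MethodOK CT L.name M

/-! ### Class types, constraints and requirements -/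

abbrev ClassVar := ℕ

inductive ClassType where
  | name : CName → ClassType
  | var : ClassVar → ClassType

/-- An atomic condition `T = T'` or `T ≠ T'`. -/
inductive CondAtom where
  | eq (T T' : ClassType) : CondAtom
  | ne (T T' : ClassType) : CondAtom

/-- A condition is a conjunction of atomic conditions. -/
abbrev Cond := List CondAtom

/-- Constraints; `eqsIf` is the equality, under a condition, of two sequences of types, which in
particular have to be equally long. -/
inductive Constraint where
  | eq (T T' : ClassType) : Constraint
  | ne (T T' : ClassType) : Constraint
  | sub (T T' : ClassType) : Constraint
  | nsub (T T' : ClassType) : Constraint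
  | eqIf (T T' : ClassType) (cond : Cond) : Constraint
  | eqsIf (Ts Ts' : List ClassType) (cond : Cond) : Constraint

/-- Class requirements. `method true T m Ts T'` is the optional requirement
`(T.m : Ts → T')_opt`, and `method false T m Ts T'` is the requirement `T.m : Ts → T'`. -/
inductive CReq where
  | ext (T T' : ClassType) : CReq
  | init (T : ClassType) (Ts : List ClassType) : CReq
  | field (T : ClassType) (f : FName) (T' : ClassType) : CReq
  | method (opt : Bool) (T : ClassType) (m : MName) (Ts : List ClassType) (T' : ClassType) : CReq

/-- The class type on which something is required. -/
def CReq.recv : CReq → ClassType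
  | .ext T _ => T
  | .init T _ => T
  | .field T _ _ => T
  | .method _ T _ _ _ => T

def CReq.slot : CReq → Slot
  | .ext _ _ => .ext
  | .init _ _ => .init
  | .field _ f _ => .field f
  | .method _ _ m _ _ => .method m

/-- Class table requirements: sets of conditional class requirements. -/
abbrev ClassReqs := Set (CReq × Cond)

/-- Context requirements: bindings from variables to class types. -/
abbrev CtxReqs := Var → Option ClassType

/-! ### Operations on requirements -/

def CtxReqs.empty : CtxReqs := fun _ => none

def CtxReqs.single (x : Var) (T : ClassType) : CtxReqs := fun y => if y = x then some T else none

/-- `R - x`. -/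
def CtxReqs.remove (R : CtxReqs) (x : Var) : CtxReqs := fun y => if y = x then none else R y

/-- The requirements of `merge_R(R₁, R₂)`. -/
def mergeR (R₁ R₂ : CtxReqs) : CtxReqs := fun x => (R₁ x).orElse fun _ => R₂ x

/-- The constraints of `merge_R(R₁, R₂)`. -/
def mergeRC (R₁ R₂ : CtxReqs) : Set Constraint :=
  {s | ∃ x T₁ T₂, R₁ x = some T₁ ∧ R₂ x = some T₂ ∧ s = .eq T₁ T₂}

/-- The requirements of `merge_R(R₁, ..., Rₙ)`. -/
def mergeRs : List CtxReqs → CtxReqs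
  | [] => .empty
  | R :: Rs => mergeR R (mergeRs Rs)

/-- The constraints of `merge_R(R₁, ..., Rₙ)`. -/
def mergeRsC : List CtxReqs → Set Constraint
  | [] => ∅
  | R :: Rs => mergeRC R (mergeRs Rs) ∪ mergeRsC Rs

/-- The constraints that two requirements on the same slot impose in case their receivers
coincide. -/
def agree : CReq → CReq → Set Constraint
  | .ext T₁ T₁', .ext T₂ T₂' => {.eqIf T₁' T₂' [.eq T₁ T₂]}
  | .init T₁ Ts₁, .init T₂ Ts₂ => {.eqsIf Ts₁ Ts₂ [.eq T₁ T₂]}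
  | .field T₁ _ T₁', .field T₂ _ T₂' => {.eqIf T₁' T₂' [.eq T₁ T₂]}
  | .method _ T₁ _ Ts₁ T₁', .method _ T₂ _ Ts₂ T₂' =>
      {.eqIf T₁' T₂' [.eq T₁ T₂], .eqsIf Ts₁ Ts₂ [.eq T₁ T₂]}
  | _, _ => ∅

/-- The single requirement into which two requirements on the same slot are merged in case their
receivers coincide: it is the first one, and it is optional only if both are. -/
def combine : CReq → CReq → CReq
  | .method o₁ T m Ts T', .method o₂ _ _ _ _ => .method (o₁ && o₂) T m Ts T'
  | r, _ => r

/-- The requirements of `merge_CR(CR₁, CR₂)`: non-overlapping requirements are kept, overlapping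
ones (those on the same slot) are split according to whether their receivers coincide. -/
def mergeCR (CR₁ CR₂ : ClassReqs) : ClassReqs :=
  {p | p ∈ CR₁ ∧ ∀ q ∈ CR₂, p.1.slot ≠ q.1.slot} ∪
  {q | q ∈ CR₂ ∧ ∀ p ∈ CR₁, p.1.slot ≠ q.1.slot} ∪
  {r | ∃ p ∈ CR₁, ∃ q ∈ CR₂, p.1.slot = q.1.slot ∧
    (r = (p.1, p.2 ++ [.ne p.1.recv q.1.recv]) ∨
     r = (q.1, q.2 ++ [.ne p.1.recv q.1.recv]) ∨
     r = (combine p.1 q.1, p.2 ++ q.2 ++ [.eq p.1.recv q.1.recv]))}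

/-- The constraints of `merge_CR(CR₁, CR₂)`. -/
def mergeCRC (CR₁ CR₂ : ClassReqs) : Set Constraint :=
  {s | ∃ p ∈ CR₁, ∃ q ∈ CR₂, p.1.slot = q.1.slot ∧ s ∈ agree p.1 q.1}

/-- The requirements of `merge_CR(CR₁, ..., CRₙ)`. -/
def mergeCRs : List ClassReqs → ClassReqs
  | [] => ∅
  | CR :: CRs => mergeCR CR (mergeCRs CRs)

/-- The constraints of `merge_CR(CR₁, ..., CRₙ)`. -/
def mergeCRsC : List ClassReqs → Set Constraint
  | [] => ∅
  | CR :: CRs => mergeCRC CR (mergeCRs CRs) ∪ mergeCRsC CRs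

/-! ### Co-contextual typing

The last index of the judgments for expressions and methods is the finite set of the class
variables that are introduced in the derivation; it serves to express freshness. -/

inductive CoHasType :
    Expr → ClassType → Set Constraint → CtxReqs → ClassReqs → Finset ClassVar → Prop
  | var {x : Var} {U : ClassVar} :
      CoHasType (.var x) (.var U) ∅ (CtxReqs.single x (.var U)) ∅ {U}
  | field {e : Expr} {f : FName} {Te : ClassType} {Se : Set Constraint} {Re : CtxReqs}
      {CRe : ClassReqs} {Fe : Finset ClassVar} {U : ClassVar} :
      CoHasType e Te Se Re CRe Fe → U ∉ Fe →
      CoHasType (.field e f) (.var U)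
        (Se ∪ mergeCRC CRe {(.field Te f (.var U), [])})
        Re
        (mergeCR CRe {(.field Te f (.var U), [])})
        (insert U Fe)
  | invk {e : Expr} {m : MName} {es : List Expr}
      {Te : ClassType} {Se : Set Constraint} {Re : CtxReqs} {CRe : ClassReqs}
      {Fe : Finset ClassVar}
      {T : Fin es.length → ClassType} {S : Fin es.length → Set Constraint}
      {R : Fin es.length → CtxReqs} {CR : Fin es.length → ClassReqs}
      {F : Fin es.length → Finset ClassVar}
      {U : Fin es.length → ClassVar} {U' : ClassVar} :
      CoHasType e Te Se Re CRe Fe →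
      (∀ i, CoHasType (es.get i) (T i) (S i) (R i) (CR i) (F i)) →
      (∀ i, Disjoint Fe (F i)) → (∀ i j, i ≠ j → Disjoint (F i) (F j)) →
      U' ∉ Fe → (∀ i, U' ∉ F i) → (∀ i, U i ∉ Fe) → (∀ i j, U i ∉ F j) →
      Function.Injective U → (∀ i, U i ≠ U') →
      CoHasType (.invk e m es) (.var U')
        ((⋃ i, S i) ∪ Se ∪ {s | ∃ i, s = .sub (T i) (.var (U i))} ∪
          mergeRsC (Re :: List.ofFn R) ∪
          mergeCRsC (CRe ::
            {(.method false Te m (List.ofFn fun i => .var (U i)) (.var U'), [])} :: List.ofFn CR))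
        (mergeRs (Re :: List.ofFn R))
        (mergeCRs (CRe ::
          {(.method false Te m (List.ofFn fun i => .var (U i)) (.var U'), [])} :: List.ofFn CR))
        (insert U' (Fe ∪ Finset.univ.biUnion F ∪ Finset.univ.image U))
  | new {C : CName} {es : List Expr}
      {T : Fin es.length → ClassType} {S : Fin es.length → Set Constraint}
      {R : Fin es.length → CtxReqs} {CR : Fin es.length → ClassReqs}
      {F : Fin es.length → Finset ClassVar} {U : Fin es.length → ClassVar} :
      (∀ i, CoHasType (es.get i) (T i) (S i) (R i) (CR i) (F i)) →
      (∀ i j, i ≠ j → Disjoint (F i) (F j)) → (∀ i j, U i ∉ F j) → Function.Injective U →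
      CoHasType (.new C es) (.name C)
        ((⋃ i, S i) ∪ {s | ∃ i, s = .sub (T i) (.var (U i))} ∪
          mergeRsC (List.ofFn R) ∪
          mergeCRsC ({(.init (.name C) (List.ofFn fun i => .var (U i)), [])} :: List.ofFn CR))
        (mergeRs (List.ofFn R))
        (mergeCRs ({(.init (.name C) (List.ofFn fun i => .var (U i)), [])} :: List.ofFn CR))
        (Finset.univ.biUnion F ∪ Finset.univ.image U)
  | ucast {C : CName} {e : Expr} {Te : ClassType} {Se : Set Constraint} {Re : CtxReqs}
      {CRe : ClassReqs} {Fe : Finset ClassVar} :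
      CoHasType e Te Se Re CRe Fe →
      CoHasType (.cast C e) (.name C) (Se ∪ {.sub Te (.name C)}) Re CRe Fe
  | dcast {C : CName} {e : Expr} {Te : ClassType} {Se : Set Constraint} {Re : CtxReqs}
      {CRe : ClassReqs} {Fe : Finset ClassVar} :
      CoHasType e Te Se Re CRe Fe →
      CoHasType (.cast C e) (.name C) (Se ∪ {.sub (.name C) Te} ∪ {.ne (.name C) Te}) Re CRe Fe
  | scast {C : CName} {e : Expr} {Te : ClassType} {Se : Set Constraint} {Re : CtxReqs}
      {CRe : ClassReqs} {Fe : Finset ClassVar} :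
      CoHasType e Te Se Re CRe Fe →
      CoHasType (.cast C e) (.name C) (Se ∪ {.nsub (.name C) Te} ∪ {.nsub Te (.name C)})
        Re CRe Fe

/-- `CoMethodOK M S Uc CR F`: the method declaration `M` is OK co-contextually, with constraints
`S`, the class variable `Uc` for the enclosing class, and class table requirements `CR`. -/
inductive CoMethodOK :
    MethodDecl → Set Constraint → ClassVar → ClassReqs → Finset ClassVar → Prop
  | mk {M : MethodDecl} {Te : ClassType} {Se : Set Constraint} {Re : CtxReqs} {CRe : ClassReqs}
      {Fe : Finset ClassVar} {Uc Ud : ClassVar} :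
      CoHasType M.body Te Se Re CRe Fe →
      M.params.foldl (fun R p => CtxReqs.remove R (.param p.2)) (CtxReqs.remove Re .this)
        = CtxReqs.empty →
      Uc ∉ Fe → Ud ∉ Fe → Uc ≠ Ud →
      CoMethodOK M
        (Se ∪ {.sub Te (.name M.ret)} ∪
          {s | ∃ T, Re .this = some T ∧ s = .eq (.var Uc) T} ∪
          mergeCRsC [CRe, {(.ext (.var Uc) (.var Ud), [])},
            {(.method true (.var Ud) M.name (M.params.map fun p => .name p.1) (.name M.ret), [])}] ∪
          {s | ∃ p ∈ M.params, ∃ T, Re (.param p.2) = some T ∧ s = .eq (.name p.1) T})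
        Uc
        (mergeCRs [CRe, {(.ext (.var Uc) (.var Ud), [])},
          {(.method true (.var Ud) M.name (M.params.map fun p => .name p.1) (.name M.ret), [])}])
        (insert Uc (insert Ud Fe))

/-- `CoClassOK L S CR`: the class declaration `L` is OK co-contextually, with constraints `S` and
class table requirements `CR`. -/
inductive CoClassOK : ClassDecl → Set Constraint → ClassReqs → Prop
  | mk {L : ClassDecl} {Dg Cf : List (CName × FName)}
      {S : Fin L.methods.length → Set Constraint} {U : Fin L.methods.length → ClassVar}
      {CR : Fin L.methods.length → ClassReqs} {F : Fin L.methods.length → Finset ClassVar} :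
      L.CtorForm Dg Cf →
      (∀ i, CoMethodOK (L.methods.get i) (S i) (U i) (CR i) (F i)) →
      (∀ i j, i ≠ j → Disjoint (F i) (F j)) →
      CoClassOK L
        ((⋃ i, S i) ∪ {s | ∃ i, s = .eq (.var (U i)) (.name L.name)} ∪
          mergeCRsC ({(.init (.name L.super) (Dg.map fun p => .name p.1), [])} :: List.ofFn CR))
        (mergeCRs ({(.init (.name L.super) (Dg.map fun p => .name p.1), [])} :: List.ofFn CR))

/-! ### Substitutions and solutions -/

/-- A substitution; a class variable on which it is not defined is mapped to itself. -/
abbrev Subst := ClassVar → ClassType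

def ClassType.subst (σ : Subst) : ClassType → ClassType
  | .name C => .name C
  | .var U => σ U

def CondAtom.subst (σ : Subst) : CondAtom → CondAtom
  | .eq T T' => .eq (T.subst σ) (T'.subst σ)
  | .ne T T' => .ne (T.subst σ) (T'.subst σ)

def CReq.subst (σ : Subst) : CReq → CReq
  | .ext T T' => .ext (T.subst σ) (T'.subst σ)
  | .init T Ts => .init (T.subst σ) (Ts.map (ClassType.subst σ))
  | .field T f T' => .field (T.subst σ) f (T'.subst σ)
  | .method o T m Ts T' => .method o (T.subst σ) m (Ts.map (ClassType.subst σ)) (T'.subst σ)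

/-- `σ(CR)`. -/
def substReqs (σ : Subst) (CR : ClassReqs) : ClassReqs :=
  {p | ∃ q ∈ CR, p = (q.1.subst σ, q.2.map (CondAtom.subst σ))}

def ClassType.Ground (T : ClassType) : Prop := ∃ C, T = .name C

def CondAtom.Ground : CondAtom → Prop
  | .eq T T' => T.Ground ∧ T'.Ground
  | .ne T T' => T.Ground ∧ T'.Ground

def CReq.Ground : CReq → Prop
  | .ext T T' => T.Ground ∧ T'.Ground
  | .init T Ts => T.Ground ∧ ∀ T' ∈ Ts, T'.Ground
  | .field T _ T' => T.Ground ∧ T'.Ground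
  | .method _ T _ Ts T' => T.Ground ∧ (∀ T'' ∈ Ts, T''.Ground) ∧ T'.Ground

def GroundReqs (CR : ClassReqs) : Prop :=
  ∀ p ∈ CR, p.1.Ground ∧ ∀ a ∈ p.2, a.Ground

def CondAtom.Holds : CondAtom → Prop
  | .eq T T' => T = T'
  | .ne T T' => T ≠ T'

def Cond.Holds (cond : Cond) : Prop := ∀ a ∈ cond, a.Holds

/-- Subtyping relative to `Sg` for class types; it only relates class names. -/
def SubType (Sg : Set (CName × CName)) (T T' : ClassType) : Prop :=
  ∃ C D, T = .name C ∧ T' = .name D ∧ SubRel Sg C D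

/-- `sat(Σ, σ, s)`. -/
def Sat (Sg : Set (CName × CName)) (σ : Subst) : Constraint → Prop
  | .eq T T' => T.subst σ = T'.subst σ
  | .ne T T' => T.subst σ ≠ T'.subst σ
  | .sub T T' => SubType Sg (T.subst σ) (T'.subst σ)
  | .nsub T T' => ¬ SubType Sg (T.subst σ) (T'.subst σ)
  | .eqIf T T' cond =>
      Cond.Holds (cond.map (CondAtom.subst σ)) → T.subst σ = T'.subst σ
  | .eqsIf Ts Ts' cond =>
      Cond.Holds (cond.map (CondAtom.subst σ)) →
        Ts.map (ClassType.subst σ) = Ts'.map (ClassType.subst σ)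

/-- `σ` is a solution of the constraints `S` relative to `Sg`. -/
def Solves (Sg : Set (CName × CName)) (S : Set Constraint) (σ : Subst) : Prop :=
  ∀ s ∈ S, Sat Sg σ s

/-! ### Satisfaction of requirements by class tables -/

/-- The class table satisfies a (ground) class requirement. -/
inductive ClassTable.SatisfiesReq (CT : ClassTable) : CReq → Prop
  | ext {C D : CName} : CT.Extends C D → CT.SatisfiesReq (.ext (.name C) (.name D))
  | init {C : CName} {Cs : List CName} : CT.Fields C Cs →
      CT.SatisfiesReq (.init (.name C) (Cs.map .name))
  | field {C C' : CName} {f : FName} : CT.Field f C C' →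
      CT.SatisfiesReq (.field (.name C) f (.name C'))
  | method {C C' : CName} {m : MName} {Cs : List CName} : CT.MType m C Cs C' →
      CT.SatisfiesReq (.method false (.name C) m (Cs.map .name) (.name C'))
  | optMethod {C C' : CName} {m : MName} {Cs : List CName} :
      (∀ Ds D', CT.MType m C Ds D' → Ds = Cs ∧ D' = C') →
      CT.SatisfiesReq (.method true (.name C) m (Cs.map .name) (.name C'))

/-- The class table satisfies every requirement whose condition holds. -/
def ClassTable.Satisfies (CT : ClassTable) (CR : ClassReqs) : Prop :=
  ∀ p ∈ CR, Cond.Holds p.2 → CT.SatisfiesReq p.1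

end FJ

/-!
Satisfying every requirement of `CR`, whether its condition holds or not, is inherited by the parts
of a merge, and makes typing sound by induction on the co-contextual derivation. A class table that
does so consists of `Σ` together with the clauses literally demanded by `σ(CR)`, where optional
requirements count as mandatory ones. It has at most one clause for each domain element because the
constraints of the merges identify the requirements on the same slot of the same class. It adds
nothing to `Σ` because each such group of requirements keeps a member whose condition holds, to
which the hypothesis on inheritance applies.
-/

namespace FJ

variable {CT : ClassTable} {Sg : Set (CName × CName)} {σ : Subst} {Γ : Ctx} {A B : ClassReqs}

/-! ### Requirements under merging and substitution -/

/-- The mandatory form of a requirement. -/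
def CReq.strict : CReq → CReq
  | .method _ T m Ts T' => .method false T m Ts T'
  | r => r

/-- The domain `T.extends`, `T.init`, `T.f` or `T.m` of a requirement, as in `Clause.dom`. -/
def CReq.dom (r : CReq) : ClassType × Slot := (r.recv, r.slot)

/-- The mandatory forms of the requirements in `CR`, regardless of their conditions. -/
def demands (CR : ClassReqs) : Set CReq := CReq.strict '' (Prod.fst '' CR)

/-- The domains of the requirements in `CR` whose condition holds. -/
def liveDoms (CR : ClassReqs) : Set (ClassType × Slot) :=
  (fun p => p.1.dom) '' {p ∈ CR | Cond.Holds p.2}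

@[simp]
theorem CReq.dom_strict (r : CReq) : r.strict.dom = r.dom := by
  cases r <;> rfl

theorem CReq.recv_subst (r : CReq) : (r.subst σ).recv = r.recv.subst σ := by
  cases r <;> rfl

theorem CReq.slot_subst (r : CReq) : (r.subst σ).slot = r.slot := by
  cases r <;> rfl

theorem combine_subst (p q : CReq) :
    (combine p q).subst σ = combine (p.subst σ) (q.subst σ) := by
  cases p <;> cases q <;> rfl

@[simp]
theorem strict_combine (p q : CReq) : (combine p q).strict = p.strict := by
  cases p <;> cases q <;> rfl

theorem dom_combine (p q : CReq) : (combine p q).dom = p.dom := by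
  rw [← CReq.dom_strict, strict_combine, CReq.dom_strict]

theorem strict_mem_demands {CR : ClassReqs} {r : CReq} {cond : Cond} (hr : (r, cond) ∈ CR) :
    r.strict ∈ demands CR :=
  ⟨r, ⟨(r, cond), hr, rfl⟩, rfl⟩

theorem substReqs_mergeCR :
    substReqs σ (mergeCR A B) = mergeCR (substReqs σ A) (substReqs σ B) := by
  ext r
  constructor
  · rintro ⟨r, (⟨hr, h⟩ | ⟨hr, h⟩) | ⟨p, hp, q, hq, hs, hr⟩, rfl⟩
    · refine .inl (.inl ⟨⟨r, hr, rfl⟩, ?_⟩)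
      rintro _ ⟨q, hq, rfl⟩
      simpa only [CReq.slot_subst] using h q hq
    · refine .inl (.inr ⟨⟨r, hr, rfl⟩, ?_⟩)
      rintro _ ⟨p, hp, rfl⟩
      simpa only [CReq.slot_subst] using h p hp
    · refine .inr ⟨_, ⟨p, hp, rfl⟩, _, ⟨q, hq, rfl⟩, by simpa only [CReq.slot_subst] using hs, ?_⟩
      rcases hr with rfl | rfl | rfl <;>
        simp [CReq.recv_subst, CondAtom.subst, combine_subst]
  · rintro ((⟨⟨r, hr, rfl⟩, h⟩ | ⟨⟨r, hr, rfl⟩, h⟩) |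
      ⟨_, ⟨p, hp, rfl⟩, _, ⟨q, hq, rfl⟩, hs, hr⟩)
    · refine ⟨r, .inl (.inl ⟨hr, fun q hq => ?_⟩), rfl⟩
      simpa only [CReq.slot_subst] using h _ ⟨q, hq, rfl⟩
    · refine ⟨r, .inl (.inr ⟨hr, fun p hp => ?_⟩), rfl⟩
      simpa only [CReq.slot_subst] using h _ ⟨p, hp, rfl⟩
    · simp only [CReq.slot_subst] at hs
      rcases hr with rfl | rfl | rfl
      · exact ⟨_, .inr ⟨p, hp, q, hq, hs, .inl rfl⟩, by simp [CReq.recv_subst, CondAtom.subst]⟩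
      · exact ⟨_, .inr ⟨p, hp, q, hq, hs, .inr (.inl rfl)⟩,
          by simp [CReq.recv_subst, CondAtom.subst]⟩
      · exact ⟨_, .inr ⟨p, hp, q, hq, hs, .inr (.inr rfl)⟩,
          by simp [CReq.recv_subst, CondAtom.subst, combine_subst]⟩

theorem substReqs_empty : substReqs σ ∅ = ∅ := by
  simp [substReqs]

theorem substReqs_singleton (r : CReq) : substReqs σ {(r, [])} = {(r.subst σ, [])} := by
  simp [substReqs]

theorem image_fst_union_subset_mergeCR :
    Prod.fst '' A ∪ Prod.fst '' B ⊆ Prod.fst '' mergeCR A B := by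
  rintro _ (⟨p, hp, rfl⟩ | ⟨q, hq, rfl⟩)
  · by_cases hB : ∀ q ∈ B, p.1.slot ≠ q.1.slot
    · exact ⟨p, .inl (.inl ⟨hp, hB⟩), rfl⟩
    · push Not at hB
      obtain ⟨q, hq, hs⟩ := hB
      exact ⟨_, .inr ⟨p, hp, q, hq, hs, .inl rfl⟩, rfl⟩
  · by_cases hA : ∀ p ∈ A, p.1.slot ≠ q.1.slot
    · exact ⟨q, .inl (.inr ⟨hq, hA⟩), rfl⟩
    · push Not at hA
      obtain ⟨p, hp, hs⟩ := hA
      exact ⟨_, .inr ⟨p, hp, q, hq, hs, .inr (.inl rfl)⟩, rfl⟩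

theorem demands_mergeCR : demands (mergeCR A B) = demands A ∪ demands B := by
  apply subset_antisymm
  · rintro _ ⟨_, ⟨_, (⟨hr, -⟩ | ⟨hr, -⟩) | ⟨p, hp, q, hq, -, rfl | rfl | rfl⟩, rfl⟩, rfl⟩
    · exact .inl (strict_mem_demands hr)
    · exact .inr (strict_mem_demands hr)
    · exact .inl (strict_mem_demands hp)
    · exact .inr (strict_mem_demands hq)
    · rw [strict_combine]
      exact .inl (strict_mem_demands hp)
  · rw [demands, demands, ← Set.image_union]
    exact Set.image_mono image_fst_union_subset_mergeCR

theorem Cond.holds_append (c d : Cond) : Cond.Holds (c ++ d) ↔ c.Holds ∧ d.Holds :=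
  List.forall_mem_append

theorem Cond.holds_singleton (a : CondAtom) : Cond.Holds [a] ↔ a.Holds :=
  List.forall_mem_singleton

theorem pair_subset_liveDoms_mergeCR {p q : CReq × Cond} (hp : p ∈ A) (hq : q ∈ B)
    (hs : p.1.slot = q.1.slot) (hpc : Cond.Holds p.2) (hqc : Cond.Holds q.2) :
    {p.1.dom, q.1.dom} ⊆ liveDoms (mergeCR A B) := by
  by_cases hr : p.1.recv = q.1.recv
  · have hdom : p.1.dom = q.1.dom := Prod.ext hr hs
    have hlive : p.1.dom ∈ liveDoms (mergeCR A B) :=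
      ⟨_, ⟨.inr ⟨p, hp, q, hq, hs, .inr (.inr rfl)⟩,
        by simpa only [Cond.holds_append, Cond.holds_singleton] using ⟨⟨hpc, hqc⟩, hr⟩⟩,
        dom_combine _ _⟩
    simpa [← hdom] using hlive
  · have hsplit (c : Cond) (hc : c.Holds) : Cond.Holds (c ++ [.ne p.1.recv q.1.recv]) := by
      simpa only [Cond.holds_append, Cond.holds_singleton] using ⟨hc, hr⟩
    rintro _ (rfl | rfl)
    · exact ⟨_, ⟨.inr ⟨p, hp, q, hq, hs, .inl rfl⟩, hsplit _ hpc⟩, rfl⟩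
    · exact ⟨_, ⟨.inr ⟨p, hp, q, hq, hs, .inr (.inl rfl)⟩, hsplit _ hqc⟩, rfl⟩

/-! ### Coherent requirements -/

/-- What the constraints of merges guarantee of solved requirements: there are finitely many
demands, at most one for each domain element, and each of these domain elements is required under
some condition that holds. -/
structure Coherent (CR : ClassReqs) : Prop where
  finite : (demands CR).Finite
  injOn_dom : Set.InjOn CReq.dom (demands CR)
  mapsTo_liveDoms : Set.MapsTo CReq.dom (demands CR) (liveDoms CR)

theorem Coherent.empty : Coherent ∅ where
  finite := by simp [demands]
  injOn_dom := by simp [demands]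
  mapsTo_liveDoms := by simp [demands, Set.MapsTo]

theorem Coherent.singleton (r : CReq) : Coherent {(r, [])} where
  finite := by simp [demands]
  injOn_dom := by simp [demands]
  mapsTo_liveDoms := by simp [demands, liveDoms, Set.MapsTo, Cond.Holds]

theorem Coherent.liveDoms_union_subset_mergeCR (hA : Coherent A) (hB : Coherent B) :
    liveDoms A ∪ liveDoms B ⊆ liveDoms (mergeCR A B) := by
  rintro _ (⟨p, ⟨hp, hpc⟩, rfl⟩ | ⟨q, ⟨hq, hqc⟩, rfl⟩)
  · by_cases hslot : ∀ q ∈ B, p.1.slot ≠ q.1.slot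
    · exact ⟨p, ⟨.inl (.inl ⟨hp, hslot⟩), hpc⟩, rfl⟩
    · push Not at hslot
      obtain ⟨q, hq, hs⟩ := hslot
      obtain ⟨q', ⟨hq', hqc'⟩, hdom⟩ := hB.mapsTo_liveDoms (strict_mem_demands hq)
      have hs' : q'.1.slot = q.1.slot :=
        congrArg Prod.snd (hdom.trans q.1.dom_strict)
      exact pair_subset_liveDoms_mergeCR hp hq' (hs.trans hs'.symm) hpc hqc' (.inl rfl)
  · by_cases hslot : ∀ p ∈ A, p.1.slot ≠ q.1.slot
    · exact ⟨q, ⟨.inl (.inr ⟨hq, hslot⟩), hqc⟩, rfl⟩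
    · push Not at hslot
      obtain ⟨p, hp, hs⟩ := hslot
      obtain ⟨p', ⟨hp', hpc'⟩, hdom⟩ := hA.mapsTo_liveDoms (strict_mem_demands hp)
      have hs' : p'.1.slot = p.1.slot :=
        congrArg Prod.snd (hdom.trans p.1.dom_strict)
      exact pair_subset_liveDoms_mergeCR hp' hq (hs'.trans hs) hpc' hqc (.inr rfl)

theorem Coherent.mergeCR (hA : Coherent A) (hB : Coherent B)
    (hAB : ∀ r ∈ demands A, ∀ r' ∈ demands B, r.dom = r'.dom → r = r') :
    Coherent (mergeCR A B) where
  finite := by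
    rw [demands_mergeCR]
    exact hA.finite.union hB.finite
  injOn_dom := by
    rw [demands_mergeCR]
    rintro r (hr | hr) r' (hr' | hr') hdom
    · exact hA.injOn_dom hr hr' hdom
    · exact hAB r hr r' hr' hdom
    · exact (hAB r' hr' r hr hdom.symm).symm
    · exact hB.injOn_dom hr hr' hdom
  mapsTo_liveDoms := by
    rw [demands_mergeCR]
    exact (hA.mapsTo_liveDoms.union_union hB.mapsTo_liveDoms).mono_right
      (hA.liveDoms_union_subset_mergeCR hB)

theorem solves_union {S S' : Set Constraint} :
    Solves Sg (S ∪ S') σ ↔ Solves Sg S σ ∧ Solves Sg S' σ := by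
  simp only [Solves, Set.mem_union, or_imp, forall_and]

theorem solves_iUnion {ι : Type*} {S : ι → Set Constraint} :
    Solves Sg (⋃ i, S i) σ ↔ ∀ i, Solves Sg (S i) σ := by
  simp only [Solves, Set.mem_iUnion, forall_exists_index]
  exact forall_comm

theorem solves_singleton {s : Constraint} : Solves Sg {s} σ ↔ Sat Sg σ s := by
  simp only [Solves, Set.mem_singleton_iff, forall_eq]

theorem strict_subst_eq_of_solves_agree {p q : CReq} (hdom : (p.subst σ).dom = (q.subst σ).dom)
    (h : Solves Sg (agree p q) σ) : (p.subst σ).strict = (q.subst σ).strict := by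
  cases p <;> cases q <;>
    simp_all [CReq.dom, CReq.slot, CReq.recv, agree, Solves, Sat, CReq.subst, CReq.strict,
      Cond.Holds, CondAtom.subst, CondAtom.Holds]

theorem eq_of_solves_mergeCRC (h : Solves Sg (mergeCRC A B) σ) :
    ∀ r ∈ demands (substReqs σ A), ∀ r' ∈ demands (substReqs σ B), r.dom = r'.dom → r = r' := by
  rintro _ ⟨_, ⟨_, ⟨p, hp, rfl⟩, rfl⟩, rfl⟩ _ ⟨_, ⟨_, ⟨q, hq, rfl⟩, rfl⟩, rfl⟩ hdom
  simp only [CReq.dom_strict] at hdom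
  have hslot : p.1.slot = q.1.slot := by
    simpa only [CReq.dom, CReq.slot_subst] using congrArg Prod.snd hdom
  exact strict_subst_eq_of_solves_agree hdom fun s hs => h s ⟨p, hp, q, hq, hslot, hs⟩

theorem Coherent.substReqs_singleton (σ : Subst) (r : CReq) :
    Coherent (substReqs σ {(r, [])}) := by
  rw [FJ.substReqs_singleton]
  exact .singleton _

theorem Coherent.substReqs_mergeCR (hA : Coherent (substReqs σ A)) (hB : Coherent (substReqs σ B))
    (h : Solves Sg (mergeCRC A B) σ) : Coherent (substReqs σ (FJ.mergeCR A B)) := by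
  rw [FJ.substReqs_mergeCR]
  exact hA.mergeCR hB (eq_of_solves_mergeCRC h)

theorem Coherent.substReqs_mergeCRs {l : List ClassReqs}
    (hl : ∀ CR ∈ l, Coherent (substReqs σ CR)) (h : Solves Sg (mergeCRsC l) σ) :
    Coherent (substReqs σ (mergeCRs l)) := by
  induction l with
  | nil =>
    rw [mergeCRs, substReqs_empty]
    exact .empty
  | cons A l ih =>
    obtain ⟨hhead, htail⟩ := List.forall_mem_cons.1 hl
    obtain ⟨hmerge, hrest⟩ := solves_union.1 h
    exact hhead.substReqs_mergeCR (ih htail hrest) hmerge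

theorem CoHasType.coherent {e : Expr} {T : ClassType} {S : Set Constraint} {R : CtxReqs}
    {CR : ClassReqs} {F : Finset ClassVar} (he : CoHasType e T S R CR F) (h : Solves Sg S σ) :
    Coherent (substReqs σ CR) := by
  induction he with
  | var =>
    rw [substReqs_empty]
    exact .empty
  | field _ _ ih =>
    obtain ⟨hSe, hmerge⟩ := solves_union.1 h
    exact (ih hSe).substReqs_mergeCR (.substReqs_singleton σ _) hmerge
  | invk _ _ _ _ _ _ _ _ _ _ ih ihs =>
    simp only [solves_union, solves_iUnion] at h
    obtain ⟨⟨⟨⟨hS, hSe⟩, -⟩, -⟩, hmerge⟩ := h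
    refine .substReqs_mergeCRs ?_ hmerge
    simp only [List.forall_mem_cons, List.forall_mem_ofFn_iff]
    exact ⟨ih hSe, .substReqs_singleton σ _, fun i => ihs i (hS i)⟩
  | new _ _ _ _ ihs =>
    simp only [solves_union, solves_iUnion] at h
    obtain ⟨⟨⟨hS, -⟩, -⟩, hmerge⟩ := h
    refine .substReqs_mergeCRs ?_ hmerge
    simp only [List.forall_mem_cons, List.forall_mem_ofFn_iff]
    exact ⟨.substReqs_singleton σ _, fun i => ihs i (hS i)⟩
  | ucast _ ih => exact ih (solves_union.1 h).1
  | dcast _ ih | scast _ ih => exact ih (solves_union.1 (solves_union.1 h).1).1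

theorem CoMethodOK.coherent {M : MethodDecl} {S : Set Constraint} {U : ClassVar} {CR : ClassReqs}
    {F : Finset ClassVar} (hM : CoMethodOK M S U CR F) (h : Solves Sg S σ) :
    Coherent (substReqs σ CR) := by
  obtain ⟨he, -, -, -, -⟩ := hM
  simp only [solves_union] at h
  obtain ⟨⟨⟨⟨hSe, -⟩, -⟩, hmerge⟩, -⟩ := h
  refine .substReqs_mergeCRs ?_ hmerge
  simp only [List.forall_mem_cons]
  exact ⟨he.coherent hSe, .substReqs_singleton σ _, .substReqs_singleton σ _,
    List.forall_mem_nil _⟩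

theorem CoClassOK.coherent {L : ClassDecl} {S : Set Constraint} {CR : ClassReqs}
    (hL : CoClassOK L S CR) (h : Solves Sg S σ) : Coherent (substReqs σ CR) := by
  obtain ⟨-, hM, -⟩ := hL
  simp only [solves_union, solves_iUnion] at h
  obtain ⟨⟨hS, -⟩, hmerge⟩ := h
  refine .substReqs_mergeCRs ?_ hmerge
  simp only [List.forall_mem_cons, List.forall_mem_ofFn_iff]
  exact ⟨.substReqs_singleton σ _, fun i => (hM i).coherent (hS i)⟩

/-! ### Typing in a class table that satisfies all requirements -/

/-- `CT` satisfies every requirement of `CR`, whether or not its condition holds. Unlike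
`ClassTable.Satisfies`, this passes from a merge to its parts. -/
def ClassTable.SatisfiesAll (CT : ClassTable) (CR : ClassReqs) : Prop :=
  ∀ r ∈ Prod.fst '' CR, CT.SatisfiesReq r

theorem ClassTable.SatisfiesAll.satisfies {CR : ClassReqs} (h : CT.SatisfiesAll CR) :
    CT.Satisfies CR :=
  fun p hp _ => h p.1 ⟨p, hp, rfl⟩

theorem ClassTable.SatisfiesAll.of_substReqs_mergeCR
    (h : CT.SatisfiesAll (substReqs σ (mergeCR A B))) :
    CT.SatisfiesAll (substReqs σ A) ∧ CT.SatisfiesAll (substReqs σ B) := by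
  rw [substReqs_mergeCR] at h
  exact ⟨fun r hr => h r (image_fst_union_subset_mergeCR (.inl hr)),
    fun r hr => h r (image_fst_union_subset_mergeCR (.inr hr))⟩

theorem ClassTable.SatisfiesAll.of_substReqs_mergeCRs {l : List ClassReqs}
    (h : CT.SatisfiesAll (substReqs σ (mergeCRs l))) :
    ∀ CR ∈ l, CT.SatisfiesAll (substReqs σ CR) := by
  induction l with
  | nil => exact List.forall_mem_nil _
  | cons A l ih =>
    obtain ⟨hhead, htail⟩ := h.of_substReqs_mergeCR
    exact List.forall_mem_cons.2 ⟨hhead, ih htail⟩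

theorem satisfiesAll_substReqs_singleton {r : CReq} :
    CT.SatisfiesAll (substReqs σ {(r, [])}) ↔ CT.SatisfiesReq (r.subst σ) := by
  simp only [substReqs_singleton, ClassTable.SatisfiesAll, Set.image_singleton,
    Set.mem_singleton_iff, forall_eq]

/-- The context `Γ` assigns to each variable the class name that `R` requires of it under `σ`. -/
def Meets (σ : Subst) (Γ : Ctx) (R : CtxReqs) : Prop :=
  ∀ x T, R x = some T → (Γ x).map .name = some (T.subst σ)

theorem Meets.of_mergeR {R₁ R₂ : CtxReqs} (h : Meets σ Γ (mergeR R₁ R₂))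
    (hs : Solves Sg (mergeRC R₁ R₂) σ) : Meets σ Γ R₁ ∧ Meets σ Γ R₂ := by
  refine ⟨fun x T hT => h x T (by simp [mergeR, hT]), fun x T hT => ?_⟩
  cases h₁ : R₁ x with
  | none => exact h x T (by simp [mergeR, h₁, hT])
  | some T₁ =>
    have hagree : T₁.subst σ = T.subst σ := hs _ ⟨x, T₁, T, h₁, hT, rfl⟩
    rw [← hagree]
    exact h x T₁ (by simp [mergeR, h₁])

theorem Meets.of_mergeRs {l : List CtxReqs} (h : Meets σ Γ (mergeRs l))
    (hs : Solves Sg (mergeRsC l) σ) : ∀ R ∈ l, Meets σ Γ R := by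
  induction l with
  | nil => exact List.forall_mem_nil _
  | cons R l ih =>
    obtain ⟨hmerge, hrest⟩ := solves_union.1 hs
    obtain ⟨hhead, htail⟩ := h.of_mergeR hmerge
    exact List.forall_mem_cons.2 ⟨hhead, ih htail hrest⟩

theorem map_name_injective : Function.Injective (List.map ClassType.name) :=
  List.map_injective_iff.2 fun _ _ => ClassType.name.inj

theorem ClassTable.SatisfiesReq.fields {C : CName} {Cs : List CName}
    (h : CT.SatisfiesReq (.init (.name C) (Cs.map .name))) : CT.Fields C Cs := by
  generalize hTs : Cs.map ClassType.name = Ts at h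
  obtain _ | h := h
  rwa [map_name_injective hTs]

theorem ClassTable.SatisfiesReq.mType {C : CName} {m : MName} {Cs : List CName} {T : ClassType}
    (h : CT.SatisfiesReq (.method false (.name C) m (Cs.map .name) T)) :
    ∃ C', T = .name C' ∧ CT.MType m C Cs C' := by
  generalize hTs : Cs.map ClassType.name = Ts at h
  obtain _ | _ | _ | h := h
  exact ⟨_, rfl, map_name_injective hTs ▸ h⟩

theorem ClassTable.SatisfiesReq.eq_of_mType {C C' D' : CName} {m : MName} {Cs Ds : List CName}
    (h : CT.SatisfiesReq (.method true (.name C) m (Cs.map .name) (.name C')))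
    (hm : CT.MType m C Ds D') : Ds = Cs ∧ D' = C' := by
  generalize hTs : Cs.map ClassType.name = Ts at h
  obtain _ | _ | _ | _ | h := h
  rw [map_name_injective hTs]
  exact h Ds D' hm

theorem subType_name_left {C : CName} {T : ClassType} :
    SubType Sg (.name C) T ↔ ∃ D, T = .name D ∧ SubRel Sg C D := by
  simp [SubType]

theorem subType_name_name {C D : CName} : SubType Sg (.name C) (.name D) ↔ SubRel Sg C D := by
  simp [SubType]

/-- Contextual typing extended to class types: as with `SubType`, only class names are types. -/
def HasClassType (CT : ClassTable) (Γ : Ctx) (e : Expr) (T : ClassType) : Prop :=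
  ∃ C, T = .name C ∧ HasType CT Γ e C

theorem HasClassType.var {x : Var} {T : ClassType} (h : (Γ x).map .name = some T) :
    HasClassType CT Γ (.var x) T := by
  obtain ⟨C, hC, rfl⟩ := Option.map_eq_some_iff.1 h
  exact ⟨C, rfl, .var hC⟩

theorem HasClassType.field {e : Expr} {f : FName} {T T' : ClassType}
    (he : HasClassType CT Γ e T) (hf : CT.SatisfiesReq (.field T f T')) :
    HasClassType CT Γ (.field e f) T' := by
  obtain ⟨C, rfl, he⟩ := he
  obtain _ | _ | hf := hf
  exact ⟨_, rfl, .field he hf⟩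

theorem exists_names_of_hasClassType_of_subType {n : ℕ} {es : Fin n → Expr}
    {Ts Ts' : Fin n → ClassType} (hes : ∀ i, HasClassType CT Γ (es i) (Ts i))
    (hsub : ∀ i, SubType CT.ext (Ts i) (Ts' i)) :
    ∃ Cs Ds : Fin n → CName, (∀ i, HasType CT Γ (es i) (Cs i)) ∧
      List.ofFn Ts' = (List.ofFn Ds).map .name ∧ ∀ i, CT.Sub (Cs i) (Ds i) := by
  choose Cs hCs hes using hes
  simp only [hCs, subType_name_left] at hsub
  choose Ds hDs hsub using hsub
  refine ⟨Cs, Ds, hes, ?_, hsub⟩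
  rw [List.map_ofFn, funext hDs]
  rfl

theorem HasClassType.invk {e : Expr} {m : MName} {es : List Expr} {T T' : ClassType}
    {Ts Ts' : Fin es.length → ClassType} (he : HasClassType CT Γ e T)
    (hes : ∀ i, HasClassType CT Γ (es.get i) (Ts i))
    (hsub : ∀ i, SubType CT.ext (Ts i) (Ts' i))
    (hm : CT.SatisfiesReq (.method false T m (List.ofFn Ts') T')) :
    HasClassType CT Γ (.invk e m es) T' := by
  obtain ⟨C, rfl, he⟩ := he
  obtain ⟨Cs, Ds, hes, hDs, hsub⟩ := exists_names_of_hasClassType_of_subType hes hsub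
  rw [hDs] at hm
  obtain ⟨C', rfl, hmtype⟩ := hm.mType
  exact ⟨C', rfl, .invk he hes hmtype hsub⟩

theorem HasClassType.new {C : CName} {es : List Expr} {Ts Ts' : Fin es.length → ClassType}
    (hes : ∀ i, HasClassType CT Γ (es.get i) (Ts i))
    (hsub : ∀ i, SubType CT.ext (Ts i) (Ts' i))
    (hinit : CT.SatisfiesReq (.init (.name C) (List.ofFn Ts'))) :
    HasClassType CT Γ (.new C es) (.name C) := by
  obtain ⟨Cs, Ds, hes, hDs, hsub⟩ := exists_names_of_hasClassType_of_subType hes hsub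
  rw [hDs] at hinit
  exact ⟨C, rfl, .new hes hinit.fields hsub⟩

theorem HasClassType.ucast {C : CName} {e : Expr} {T : ClassType} (he : HasClassType CT Γ e T)
    (hsub : SubType CT.ext T (.name C)) : HasClassType CT Γ (.cast C e) (.name C) := by
  obtain ⟨D, rfl, he⟩ := he
  exact ⟨C, rfl, .ucast he (subType_name_name.1 hsub)⟩

theorem HasClassType.dcast {C : CName} {e : Expr} {T : ClassType} (he : HasClassType CT Γ e T)
    (hsub : SubType CT.ext (.name C) T) (hne : .name C ≠ T) :
    HasClassType CT Γ (.cast C e) (.name C) := by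
  obtain ⟨D, rfl, he⟩ := he
  exact ⟨C, rfl, .dcast he (subType_name_name.1 hsub) (ne_of_apply_ne _ hne)⟩

theorem HasClassType.scast {C : CName} {e : Expr} {T : ClassType} (he : HasClassType CT Γ e T)
    (hCT : ¬ SubType CT.ext (.name C) T) (hTC : ¬ SubType CT.ext T (.name C)) :
    HasClassType CT Γ (.cast C e) (.name C) := by
  obtain ⟨D, rfl, he⟩ := he
  rw [subType_name_name] at hCT hTC
  exact ⟨C, rfl, .scast he hCT hTC⟩

theorem CoHasType.hasClassType {e : Expr} {T : ClassType} {S : Set Constraint} {R : CtxReqs}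
    {CR : ClassReqs} {F : Finset ClassVar} (he : CoHasType e T S R CR F)
    (h : Solves CT.ext S σ) (hΓ : Meets σ Γ R) (hCR : CT.SatisfiesAll (substReqs σ CR)) :
    HasClassType CT Γ e (T.subst σ) := by
  induction he with
  | var => exact .var (hΓ _ _ (by simp [CtxReqs.single]))
  | field _ _ ih =>
    obtain ⟨hCRe, hf⟩ := hCR.of_substReqs_mergeCR
    exact .field (ih (solves_union.1 h).1 hΓ hCRe) (satisfiesAll_substReqs_singleton.1 hf)
  | invk _ _ _ _ _ _ _ _ _ _ ih ihs =>
    simp only [solves_union, solves_iUnion] at h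
    obtain ⟨⟨⟨⟨hS, hSe⟩, hsub⟩, hR⟩, -⟩ := h
    have hΓs := hΓ.of_mergeRs hR
    have hCRs := hCR.of_substReqs_mergeCRs
    simp only [List.forall_mem_cons, List.forall_mem_ofFn_iff,
      satisfiesAll_substReqs_singleton] at hΓs hCRs
    obtain ⟨hCRe, hm, hCRes⟩ := hCRs
    rw [CReq.subst, List.map_ofFn] at hm
    exact .invk (ih hSe hΓs.1 hCRe) (fun i => ihs i (hS i) (hΓs.2 i) (hCRes i))
      (fun i => hsub _ ⟨i, rfl⟩) hm
  | new _ _ _ _ ihs =>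
    simp only [solves_union, solves_iUnion] at h
    obtain ⟨⟨⟨hS, hsub⟩, hR⟩, -⟩ := h
    have hΓs := hΓ.of_mergeRs hR
    have hCRs := hCR.of_substReqs_mergeCRs
    simp only [List.forall_mem_cons, List.forall_mem_ofFn_iff,
      satisfiesAll_substReqs_singleton] at hΓs hCRs
    obtain ⟨hinit, hCRes⟩ := hCRs
    rw [CReq.subst, List.map_ofFn] at hinit
    exact .new (fun i => ihs i (hS i) (hΓs i) (hCRes i)) (fun i => hsub _ ⟨i, rfl⟩) hinit
  | ucast _ ih =>
    simp only [solves_union, solves_singleton] at h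
    exact (ih h.1 hΓ hCR).ucast h.2
  | dcast _ ih =>
    simp only [solves_union, solves_singleton] at h
    exact (ih h.1.1 hΓ hCR).dcast h.1.2 h.2
  | scast _ ih =>
    simp only [solves_union, solves_singleton] at h
    exact (ih h.1.1 hΓ hCR).scast h.1.2 h.2

theorem foldl_remove_param_apply {params : List (CName × ℕ)} {x : Var}
    (hx : ∀ p ∈ params, x ≠ .param p.2) (R : CtxReqs) :
    params.foldl (fun R p => CtxReqs.remove R (.param p.2)) R x = R x := by
  induction params generalizing R with
  | nil => rfl
  | cons p params ih =>
    obtain ⟨hp, hparams⟩ := List.forall_mem_cons.1 hx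
    rw [List.foldl_cons, ih hparams, CtxReqs.remove, if_neg hp]

theorem exists_mem_params_of_foldl_remove_eq_empty {params : List (CName × ℕ)} {R : CtxReqs}
    (h : params.foldl (fun R p => CtxReqs.remove R (.param p.2)) (CtxReqs.remove R .this)
      = CtxReqs.empty) {x : ℕ} {T : ClassType} (hT : R (.param x) = some T) :
    ∃ p ∈ params, p.2 = x := by
  by_contra! hx
  have hkeep := foldl_remove_param_apply (x := .param x)
    (fun p hp heq => hx p hp (Var.param.inj heq).symm) (CtxReqs.remove R .this)
  simp [h, CtxReqs.empty, CtxReqs.remove, hT] at hkeep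

theorem exists_mem_methodCtx_param {params : List (CName × ℕ)} {p : CName × ℕ} (hp : p ∈ params)
    (C : CName) :
    ∃ q ∈ params, q.2 = p.2 ∧ methodCtx params C (.param p.2) = some q.1 := by
  have hfind : (params.find? fun q => q.2 = p.2).isSome :=
    List.find?_isSome.2 ⟨p, hp, by simp⟩
  obtain ⟨q, hq⟩ := Option.isSome_iff_exists.1 hfind
  exact ⟨q, List.mem_of_find?_eq_some hq, by simpa using List.find?_some hq,
    by simp [methodCtx, hq]⟩

theorem meets_methodCtx {params : List (CName × ℕ)} {C : CName} {R : CtxReqs}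
    (hempty : params.foldl (fun R p => CtxReqs.remove R (.param p.2)) (CtxReqs.remove R .this)
      = CtxReqs.empty)
    (hthis : ∀ T, R .this = some T → T.subst σ = .name C)
    (hparams : ∀ p ∈ params, ∀ T, R (.param p.2) = some T → T.subst σ = .name p.1) :
    Meets σ (methodCtx params C) R := by
  rintro (_ | x) T hT
  · rw [hthis T hT]
    rfl
  · obtain ⟨p, hp, rfl⟩ := exists_mem_params_of_foldl_remove_eq_empty hempty hT
    obtain ⟨q, hq, hqp, hctx⟩ := exists_mem_methodCtx_param hp C
    rw [hctx, hparams q hq T (hqp ▸ hT)]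
    rfl

theorem MethodOK.of_hasClassType {C : CName} {M : MethodDecl} {T T' : ClassType}
    (hbody : HasClassType CT (methodCtx M.params C) M.body T)
    (hret : SubType CT.ext T (.name M.ret)) (hext : CT.SatisfiesReq (.ext (.name C) T'))
    (hover : CT.SatisfiesReq
      (.method true T' M.name ((M.params.map Prod.fst).map .name) (.name M.ret))) :
    MethodOK CT C M := by
  obtain ⟨E, rfl, hbody⟩ := hbody
  obtain ⟨hext⟩ := hext
  refine ⟨⟨E, hbody, subType_name_name.1 hret⟩, _, hext, fun Ds D₀ hm => ?_⟩
  obtain ⟨hDs, hD₀⟩ := hover.eq_of_mType hm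
  exact ⟨hDs.symm, hD₀.symm⟩

theorem CoMethodOK.methodOK {M : MethodDecl} {C : CName} {S : Set Constraint} {U : ClassVar}
    {CR : ClassReqs} {F : Finset ClassVar} (hM : CoMethodOK M S U CR F)
    (h : Solves CT.ext S σ) (hU : σ U = .name C) (hCR : CT.SatisfiesAll (substReqs σ CR)) :
    MethodOK CT C M := by
  obtain ⟨he, hempty, -, -, -⟩ := hM
  simp only [solves_union, solves_singleton] at h
  obtain ⟨⟨⟨⟨hSe, hret⟩, hthis⟩, -⟩, hparams⟩ := h
  have hCRs := hCR.of_substReqs_mergeCRs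
  simp only [List.forall_mem_cons, satisfiesAll_substReqs_singleton] at hCRs
  obtain ⟨hCRe, hext, hover, -⟩ := hCRs
  have hΓ := meets_methodCtx hempty
    (fun T hT => (hthis _ ⟨T, hT, rfl⟩).symm.trans hU)
    (fun p hp T hT => (hparams _ ⟨p, hp, T, hT, rfl⟩).symm)
  refine .of_hasClassType (he.hasClassType hSe hΓ hCRe) hret
    (by simpa only [CReq.subst, ClassType.subst, hU] using hext) ?_
  simpa [CReq.subst, ClassType.subst, Function.comp_def] using hover

theorem CoClassOK.classOK {L : ClassDecl} {S : Set Constraint} {CR : ClassReqs}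
    (hL : CoClassOK L S CR) (h : Solves CT.ext S σ) (hCR : CT.SatisfiesAll (substReqs σ CR)) :
    ClassOK CT L := by
  obtain ⟨hform, hM, -⟩ := hL
  simp only [solves_union, solves_iUnion] at h
  obtain ⟨⟨hS, hU⟩, -⟩ := h
  have hCRs := hCR.of_substReqs_mergeCRs
  simp only [List.forall_mem_cons, List.forall_mem_ofFn_iff,
    satisfiesAll_substReqs_singleton] at hCRs
  obtain ⟨hinit, hCRMs⟩ := hCRs
  refine ⟨_, _, hform, ClassTable.SatisfiesReq.fields ?_, List.forall_mem_iff_get.2 fun i =>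
    (hM i).methodOK (hS i) (hU _ ⟨i, rfl⟩) (hCRMs i)⟩
  simpa [CReq.subst, ClassType.subst, Function.comp_def] using hinit

/-! ### The class table demanded by ground requirements -/

/-- The mandatory requirement for which the clause literally is the answer. -/
def Clause.toReq : Clause → CReq
  | .ext C D => .ext (.name C) (.name D)
  | .init C Cs => .init (.name C) (Cs.map .name)
  | .field C f C' => .field (.name C) f (.name C')
  | .method C m Cs C' => .method false (.name C) m (Cs.map .name) (.name C')

theorem Clause.toReq_injective : Function.Injective Clause.toReq := by
  rintro (_ | _ | _ | _) (_ | _ | _ | _) h <;>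
    simp_all [Clause.toReq, map_name_injective.eq_iff]

theorem Clause.dom_toReq (c : Clause) : c.toReq.dom = (.name c.dom.1, c.dom.2) := by
  cases c <;> rfl

theorem exists_map_name_eq {Ts : List ClassType} (h : ∀ T ∈ Ts, T.Ground) :
    ∃ Cs : List CName, Cs.map .name = Ts := by
  have hrange : Ts ∈ {l | ∀ T ∈ l, T ∈ Set.range ClassType.name} :=
    fun T hT => (h T hT).imp fun _ => Eq.symm
  rwa [← Set.range_list_map] at hrange

theorem CReq.Ground.exists_toReq_eq_strict {r : CReq} (h : r.Ground) :
    ∃ c : Clause, c.toReq = r.strict := by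
  cases r with
  | ext =>
    obtain ⟨⟨C, rfl⟩, D, rfl⟩ := h
    exact ⟨.ext C D, rfl⟩
  | init =>
    obtain ⟨⟨C, rfl⟩, hTs⟩ := h
    obtain ⟨Cs, rfl⟩ := exists_map_name_eq hTs
    exact ⟨.init C Cs, rfl⟩
  | field _ f =>
    obtain ⟨⟨C, rfl⟩, C', rfl⟩ := h
    exact ⟨.field C f C', rfl⟩
  | method _ _ m =>
    obtain ⟨⟨C, rfl⟩, hTs, C', rfl⟩ := h
    obtain ⟨Cs, rfl⟩ := exists_map_name_eq hTs
    exact ⟨.method C m Cs C', rfl⟩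

theorem ClassTable.MType.unique {C C' D' : CName} {m : MName} {Cs Ds : List CName}
    (h : CT.MType m C Cs C') (h' : CT.MType m C Ds D') : Cs = Ds ∧ C' = D' := by
  induction h with
  | here hc =>
    cases h' with
    | here hd =>
      obtain ⟨-, -, hCs, hC'⟩ := Clause.method.inj (CT.unique _ hc _ hd rfl)
      exact ⟨hCs, hC'⟩
    | up hnone => exact absurd hc (hnone _ _)
  | up hnone hext _ ih =>
    cases h' with
    | here hd => exact absurd hd (hnone _ _)
    | up _ hext' h' =>
      obtain ⟨-, rfl⟩ := Clause.ext.inj (CT.unique _ hext _ hext' rfl)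
      exact ih h'

theorem ClassTable.SatisfiesReq.of_strict {r : CReq} (h : CT.SatisfiesReq r.strict) :
    CT.SatisfiesReq r := by
  cases r with
  | ext | init | field => exact h
  | method o T m Ts T' =>
    cases o with
    | false => exact h
    | true =>
      obtain _ | _ | _ | hm := h
      exact .optMethod fun Ds D' hm' => hm'.unique hm

theorem ClassTable.satisfiesReq_toReq {c : Clause} (hc : c ∈ CT.clauses) :
    CT.SatisfiesReq c.toReq := by
  cases c with
  | ext => exact .ext hc
  | init => exact .init hc
  | field => exact .field (.here hc)
  | method => exact .method (.here hc)

theorem ClassTable.exists_ext_eq_of_injOn_dom (CT₀ : ClassTable) {K : Set Clause}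
    (hfin : K.Finite) (hdom : Set.InjOn Clause.dom K)
    (hext : ∀ C D, Clause.ext C D ∈ K → (C, D) ∈ CT₀.ext) :
    ∃ CT : ClassTable, CT.ext = CT₀.ext ∧ K ⊆ CT.clauses := by
  let inherited : Set Clause := {c ∈ CT₀.clauses | c.dom.2 = .ext}
  have hcross : ∀ c ∈ inherited, ∀ k ∈ K, c.dom = k.dom → c = k := by
    rintro c ⟨hc, hslot⟩ k hk hck
    rw [hck] at hslot
    cases k with
    | ext C D => exact CT₀.unique c hc _ (hext C D hk) hck
    | _ => cases hslot
  refine ⟨⟨inherited ∪ K, (CT₀.finite.subset fun c hc => hc.1).union hfin, ?_⟩, ?_,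
    Set.subset_union_right⟩
  · rintro c (hc | hc) c' (hc' | hc') hcc'
    · exact CT₀.unique c hc.1 c' hc'.1 hcc'
    · exact hcross c hc c' hc' hcc'
    · exact (hcross c' hc' c hc hcc'.symm).symm
    · exact hdom hc hc' hcc'
  · ext ⟨C, D⟩
    exact ⟨fun h => h.elim And.left (hext C D), fun h => .inl ⟨h, rfl⟩⟩

theorem Coherent.exists_ext_mem_and_holds {CR : ClassReqs} (h : Coherent CR) {T T' : ClassType}
    (hmem : CReq.ext T T' ∈ demands CR) : ∃ cond, (CReq.ext T T', cond) ∈ CR ∧ cond.Holds := by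
  obtain ⟨⟨r, cond⟩, ⟨hr, hcond⟩, hdom⟩ := h.mapsTo_liveDoms hmem
  have hstrict : r.strict = .ext T T' :=
    h.injOn_dom (strict_mem_demands hr) hmem (r.dom_strict.trans hdom)
  cases r with
  | ext => exact ⟨cond, hstrict ▸ hr, hcond⟩
  | _ => cases hstrict

theorem Coherent.exists_classTable {CR : ClassReqs} (h : Coherent CR)
    (hground : ∀ r ∈ Prod.fst '' CR, r.Ground) (CT₀ : ClassTable)
    (hinh : ∀ C D cond, (CReq.ext (.name C) (.name D), cond) ∈ CR → Cond.Holds cond →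
      (C, D) ∈ CT₀.ext) :
    ∃ CT : ClassTable, CT.ext = CT₀.ext ∧ CT.SatisfiesAll CR := by
  let demanded : Set Clause := Clause.toReq ⁻¹' demands CR
  have hfin : demanded.Finite := h.finite.preimage Clause.toReq_injective.injOn
  have hdom : Set.InjOn Clause.dom demanded := fun c hc c' hc' hcc' =>
    Clause.toReq_injective (h.injOn_dom hc hc' (by simp only [Clause.dom_toReq, hcc']))
  have hext (C D : CName) (hCD : Clause.ext C D ∈ demanded) : (C, D) ∈ CT₀.ext := by
    obtain ⟨cond, hmem, hcond⟩ := h.exists_ext_mem_and_holds hCD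
    exact hinh C D cond hmem hcond
  obtain ⟨CT, hCT, hsub⟩ := CT₀.exists_ext_eq_of_injOn_dom hfin hdom hext
  refine ⟨CT, hCT, fun r hr => .of_strict ?_⟩
  obtain ⟨c, hc⟩ := (hground r hr).exists_toReq_eq_strict
  have hdemanded : c ∈ demanded := ⟨r, hr, hc.symm⟩
  exact hc ▸ ClassTable.satisfiesReq_toReq (hsub hdemanded)

end FJ

theorem mainTheorem6 (L : FJ.ClassDecl) (S : Set FJ.Constraint) (CR : FJ.ClassReqs)
    (Sg : Set (FJ.CName × FJ.CName)) (σ : FJ.Subst)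
    (hL : FJ.CoClassOK L S CR)
    (hsolve : FJ.Solves Sg S σ)
    (hground : FJ.GroundReqs (FJ.substReqs σ CR))
    (hSg : ∃ CT₀ : FJ.ClassTable, CT₀.ext = Sg)
    (hinh : ∀ (C D : FJ.CName) (cond : FJ.Cond),
      (FJ.CReq.ext (.name C) (.name D), cond) ∈ FJ.substReqs σ CR →
      FJ.Cond.Holds cond → (C, D) ∈ Sg) :
    ∃ CT : FJ.ClassTable,
      FJ.ClassOK CT L ∧ CT.Satisfies (FJ.substReqs σ CR) ∧ CT.ext = Sg := by
  obtain ⟨CT₀, rfl⟩ := hSg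
  obtain ⟨CT, hext, hCT⟩ := (hL.coherent hsolve).exists_classTable
    (Set.forall_mem_image.2 fun _ hp => (hground _ hp).1) CT₀ hinh
  rw [← hext] at hsolve
  exact ⟨CT, hL.classOK hsolve hCT, hCT.satisfies, hext⟩
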